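/- Let $(R,\mathfrak m)$ be a one-dimensional Noetherian local domain with infinite residue field and field of fractions $K$, such that the integral closure $\overline R$ of $R$ in $K$ is a finite $R$-module and a discrete valuation ring, and such that the natural map $R/\mathfrak m\to \overline R/\mathfrak m_{\overline R}$ is an isomorphism ($\mathfrak m_{\overline R}$ being the maximal ideal of $\overline R$). Assume that $\mathfrak m$ is not principal. For $R$-submodules $A,B\subseteq K$ put $A:B=\{z\in K : zB\subseteq A\}$, and let $\ell_R$ denote the length of an $R$-module. Let - $\gamma_R=R:\overline R$ be the conductor, $c=\ell_R(\overline R/\gamma_R)$ and $\delta=\ell_R(\overline R/R)$; - $\Lambda(\mathfrak m)=\bigcup_{n\ge 0}(\mathfrak m^n:\mathfrak m^n)$ be the blowing-up of $R$ along $\mathfrak m$; - $\mu=\ell_R(\mathfrak m/\mathfrak m^2)$ be the embedding dimension, and $e=h(1)$ the multiplicity of $R$, where $h$ is the polynomial with $\sum_{n\ge 0}\ell_R(\mathfrak m^n/\mathfrak m^{n+1})z^n=h(z)/(1-z)$; - $x\in\mathfrak m$ be a minimal reduction of $\mathfrak m$, that is, an element with $\mathfrak m^{n+1}=x\mathfrak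 m^n$ for all large $n$, and $\nu$ the reduction exponent, that is, the least integer $\nu\ge 0$ such that $\mathfrak m^{n+1}=x\mathfrak m^n$ for all $n\ge\nu$. Then the following conditions are equivalent: 1. $\gamma_R=\mathfrak m^2$; 2. $\Lambda(\mathfrak m)=\overline R$, $\ e-(\mu+1)=\tfrac12(2\delta-c)$, and $\nu=2$. -/

import Mathlib

noncomputable section

namespace BlowUp

open IsLocalRing Polynomial

section Length

variable {R M : Type*} [CommRing R] [AddCommGroup M] [Module R M]

/-- The length `l_R(N / P)` for submodules `P ≤ N` of a module, as a natural number
(every length used below is finite). -/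
def quotLength (N P : Submodule R M) : ℕ :=
  (Module.length R (N ⧸ P.submoduleOf N)).toNat

end Length

section Ideals

variable {R : Type*} [CommRing R]

/-- The Hilbert function `H_I(n) = l_R(I ^ n / I ^ (n + 1))`. -/
def hilbertFunction (I : Ideal R) (n : ℕ) : ℕ :=
  quotLength (I ^ n) (I ^ (n + 1))

/-- The Hilbert-Poincaré series `P_I(z) = ∑ H_I(n) z ^ n`. -/
def hilbertSeries (I : Ideal R) : PowerSeries ℤ :=
  PowerSeries.mk fun n => (hilbertFunction I n : ℤ)

open Classical in
/-- The `h`-polynomial of `I`: the polynomial `h` with `h(z) = (1 - z) P_I(z)`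
(it is unique when it exists; the value is `0` if there is none). -/
def hPolynomial (I : Ideal R) : ℤ[X] :=
  if H : ∃ h : ℤ[X], (h : PowerSeries ℤ) = (1 - PowerSeries.X) * hilbertSeries I
  then H.choose else 0

/-- The multiplicity `e(I) = h_I(1)`. -/
def multiplicity (I : Ideal R) : ℤ :=
  (hPolynomial I).eval 1

/-- `x ∈ I` is a minimal reduction of `I`: `I ^ (n + 1) = x I ^ n` for all large `n`. -/
def IsMinimalReduction (I : Ideal R) (x : R) : Prop :=
  x ∈ I ∧ ∃ N : ℕ, ∀ n ≥ N, I ^ (n + 1) = Ideal.span {x} * I ^ n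

/-- The reduction exponent of `I` with respect to the minimal reduction `x`:
the least `ν` such that `I ^ (n + 1) = x I ^ n` for all `n ≥ ν`. -/
def reductionExponent (I : Ideal R) (x : R) : ℕ :=
  sInf {ν : ℕ | ∀ n ≥ ν, I ^ (n + 1) = Ideal.span {x} * I ^ n}

variable (R) in
/-- The embedding dimension `μ = l_R(𝔪 / 𝔪 ^ 2)`. -/
def embDim [IsLocalRing R] : ℕ :=
  quotLength (maximalIdeal R) (maximalIdeal R ^ 2)

end Ideals

section Fractional

variable {R : Type*} (K : Type*) [CommRing R] [Field K] [Algebra R K]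

/-- An ideal of `R`, viewed as an `R`-submodule of `K`. -/
abbrev toK (I : Ideal R) : Submodule R K :=
  IsLocalization.coeSubmodule K I

variable (R) in
/-- The integral closure of `R` in `K`, as an `R`-submodule of `K`. -/
abbrev Rbar : Submodule R K :=
  Subalgebra.toSubmodule (integralClosure R K)

/-- The blowing-up `Λ(I) = ⋃ₙ (I ^ n : I ^ n)` of `R` along `I`, inside `K`.
Here `A / B` is Mathlib's `{z ∈ K | z B ⊆ A}`; the supremum of these submodules is their union,
see `coe_blowup`. -/
def blowup (I : Ideal R) : Submodule R K :=
  ⨆ n : ℕ, toK K (I ^ n) / toK K (I ^ n)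

theorem coe_blowup (I : Ideal R) :
    (blowup K I : Set K) = ⋃ n : ℕ, ((toK K (I ^ n) / toK K (I ^ n) : Submodule R K) : Set K) := by
  refine Submodule.coe_iSup_of_directed _ (Monotone.directed_le (monotone_nat_of_le_succ ?_))
  intro n z hz
  rw [Submodule.mem_div_iff_forall_mul_mem] at hz ⊢
  intro y hy
  simp only [toK, pow_succ, IsLocalization.coeSubmodule_mul] at hz hy ⊢
  induction hy using Submodule.mul_induction_on' with
  | mem_mul_mem a ha b hb =>
    rw [← mul_assoc]
    exact Submodule.mul_mem_mul (hz a ha) hb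
  | add a _ b _ iha ihb =>
    rw [mul_add]
    exact add_mem iha ihb

variable (R) in
/-- The conductor `γ_R = R : R̄ = {z ∈ K | z R̄ ⊆ R}`. -/
def conductor : Submodule R K :=
  1 / Rbar R K

variable (R) in
/-- `c = l_R(R̄ / γ_R)`. -/
def conductorExponent : ℕ :=
  quotLength (Rbar R K) (conductor R K)

variable (R) in
/-- The singularity degree `δ = l_R(R̄ / R)`. -/
def singularityDegree : ℕ :=
  quotLength (Rbar R K) 1

variable (R) in
/-- `R` is residually rational: the natural map from `R` to the residue field of `R̄` is
surjective, i.e. it induces an isomorphism of residue fields. -/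
def IsResiduallyRational [IsLocalRing (integralClosure R K)] : Prop :=
  Function.Surjective (algebraMap R (ResidueField (integralClosure R K)))

end Fractional

end BlowUp

end

/-! Write `𝔪` for the maximal ideal and `R̄` for the integral closure. Everything turns on the
equality `𝔪² = x²R̄`. The inclusion `𝔪ᵏ ⊆ xᵏR̄` always holds, by the determinant trick
(`IsMinimalReduction.toK_pow_le_scaledRbar`). The reverse inclusion for `k = 2` follows from either
condition: if `γ = 𝔪²`, because `γ` is an `R̄`-module containing `x²`; if `Λ(𝔪) = R̄` and `ν = 2`,
by cancelling a power of `x` (`scaledRbar_le_of_blowup_eq`).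

Once `𝔪² = x²R̄`, one has `e = ℓ(R̄/xR̄)`, and computing `ℓ(R̄/𝔪²)` along `xR̄` and along `𝔪 ⊆ R`
gives `2e = μ + 1 + δ`. So the numerical condition says exactly `c = 2e`, that is `ℓ(R̄/γ) =
ℓ(R̄/𝔪²)`. As `𝔪² = x²R̄ ⊆ γ`, this amounts to `γ = 𝔪²`. That `ν` is not smaller than 2 is
Nakayama's lemma. -/

namespace BlowUp

open IsLocalRing Polynomial

/-! ### Lengths of subquotients -/

section Length

variable {R M M' : Type*} [CommRing R] [AddCommGroup M] [Module R M] [AddCommGroup M'] [Module R M']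

/-- Length is additive along a chain of submodules `P ≤ N ≤ L`. -/
theorem length_quotient_add {P N L : Submodule R M} (hPN : P ≤ N) (hNL : N ≤ L) :
    Module.length R (L ⧸ P.submoduleOf L) =
      Module.length R (N ⧸ P.submoduleOf N) + Module.length R (L ⧸ N.submoduleOf L) := by
  have h₁ : P.submoduleOf N ≤ (P.submoduleOf L).comap (Submodule.inclusion hNL) := fun z hz => hz
  have h₂ : P.submoduleOf L ≤ (N.submoduleOf L).comap LinearMap.id := fun z hz => hPN hz
  refine Module.length_eq_add_of_exact
    (Submodule.mapQ _ _ (Submodule.inclusion hNL) h₁) (Submodule.mapQ _ _ LinearMap.id h₂) ?_ ?_ ?_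
  · rw [← LinearMap.ker_eq_bot, Submodule.mapQ, Submodule.ker_liftQ_eq_bot]
    exact fun z hz => (Submodule.Quotient.mk_eq_zero (P.submoduleOf L)).1 hz
  · intro z
    obtain ⟨z, rfl⟩ := Submodule.mkQ_surjective _ z
    exact ⟨Submodule.Quotient.mk z, rfl⟩
  · intro z
    obtain ⟨z, rfl⟩ := Submodule.mkQ_surjective _ z
    constructor
    · intro hz
      have hz' : (z : M) ∈ N := (Submodule.Quotient.mk_eq_zero (N.submoduleOf L)).1 hz
      exact ⟨Submodule.Quotient.mk ⟨z, hz'⟩, rfl⟩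
    · rintro ⟨w, hw⟩
      obtain ⟨w, rfl⟩ := Submodule.mkQ_surjective _ w
      rw [← hw]
      exact (Submodule.Quotient.mk_eq_zero (N.submoduleOf L)).2 w.2

theorem quotLength_add {P N L : Submodule R M} (hPN : P ≤ N) (hNL : N ≤ L)
    (hfin : Module.length R (L ⧸ P.submoduleOf L) ≠ ⊤) :
    quotLength L P = quotLength N P + quotLength L N := by
  have h := length_quotient_add hPN hNL
  rw [h] at hfin
  replace hfin := WithTop.add_ne_top.1 hfin
  rw [quotLength, h, ENat.toNat_add hfin.1 hfin.2]
  rfl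

theorem quotLength_map (f : M →ₗ[R] M') (hf : Function.Injective f) {P N : Submodule R M} :
    quotLength (N.map f) (P.map f) = quotLength N P := by
  rw [quotLength, quotLength]
  congr 1
  refine (LinearEquiv.length_eq (Submodule.Quotient.equiv _ _
    (Submodule.equivMapOfInjective f hf N) ?_)).symm
  ext ⟨z, hz⟩
  constructor
  · rintro ⟨w, hw, h⟩
    rw [← h]
    exact ⟨w, hw, rfl⟩
  · rintro ⟨w, hw, h⟩
    obtain ⟨v, hv, rfl⟩ := hz
    obtain rfl := hf h
    exact ⟨⟨w, hv⟩, hw, rfl⟩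

/-- Between submodules `P ≤ N ≤ L` with `L / P` of finite length, equality of lengths forces
`P = N`. -/
theorem eq_of_quotLength_eq {P N L : Submodule R M} (hPN : P ≤ N) (hNL : N ≤ L)
    (hfin : Module.length R (L ⧸ P.submoduleOf L) ≠ ⊤) (h : quotLength L P = quotLength L N) :
    P = N := by
  have h0 : quotLength N P = 0 := by
    have := quotLength_add hPN hNL hfin
    omega
  have hle := length_quotient_add hPN hNL
  rw [hle] at hfin
  replace hfin := WithTop.add_ne_top.1 hfin
  -- A truncated length is 0 also when the length is infinite; finiteness rules that case out.
  rw [quotLength, ENat.toNat_eq_zero] at h0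
  have h0' := h0.resolve_right hfin.1
  rw [Module.length_eq_zero_iff, Submodule.Quotient.subsingleton_iff,
    Submodule.submoduleOf_eq_top] at h0'
  exact le_antisymm hPN h0'

/-- A finite module over a Noetherian local ring killed by a power of the maximal ideal has
finite length. -/
theorem length_ne_top_of_pow_smul_eq_zero [IsLocalRing R] [IsNoetherianRing R] [Module.Finite R M]
    {n : ℕ} (hn : n ≠ 0) (h : ∀ a ∈ maximalIdeal R ^ n, ∀ z : M, a • z = 0) :
    Module.length R M ≠ ⊤ := by
  set I := maximalIdeal R ^ n
  have hI : maximalIdeal R ∈ I.minimalPrimes :=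
    ⟨⟨inferInstance, Ideal.pow_le_self hn⟩,
      fun J hJ _ => hJ.1.le_of_pow_le hJ.2⟩
  have := quotient_artinian_of_mem_minimalPrimes_of_isLocalRing I hI
  have hM : Module.IsTorsionBySet R M I := fun z a => h a a.2 z
  let := hM.module
  have : IsScalarTower R (R ⧸ I) M := hM.isScalarTower
  have : Module.Finite (R ⧸ I) M := Module.Finite.of_restrictScalars_finite R _ _
  rw [Module.length_eq_of_surjective (R := R ⧸ I) Ideal.Quotient.mk_surjective]
  exact Module.length_ne_top

end Length

/-! ### Reductions and the multiplicity -/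

section Hilbert

variable {R : Type*} [CommRing R]

theorem pow_add_eq_of_reduction {I : Ideal R} {x : R} {N : ℕ}
    (h : ∀ n ≥ N, I ^ (n + 1) = Ideal.span {x} * I ^ n) {n : ℕ} (hn : N ≤ n) (k : ℕ) :
    I ^ (n + k) = Ideal.span {x ^ k} * I ^ n := by
  induction k with
  | zero => simp
  | succ k ih =>
    rw [← add_assoc, h _ (by omega), ih, ← mul_assoc, Ideal.span_singleton_mul_span_singleton,
      pow_succ']

theorem IsMinimalReduction.ne_zero [IsDomain R] {I : Ideal R} {x : R} (hx : IsMinimalReduction I x)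
    (hI : I ≠ ⊥) : x ≠ 0 := by
  rintro rfl
  obtain ⟨-, N, hN⟩ := hx
  have := hN N le_rfl
  rw [Ideal.span_singleton_eq_bot.2 rfl, Ideal.bot_mul] at this
  exact hI (eq_bot_iff.2 (eq_zero_of_pow_eq_zero this).le)

/-- If the Hilbert function is eventually constant, the constant is the multiplicity. -/
theorem multiplicity_eq_of_hilbertFunction_eq {I : Ideal R} {N E : ℕ}
    (h : ∀ n ≥ N, hilbertFunction I n = E) : multiplicity I = E := by
  -- From degree `N` on the series is `E zᴺ/(1 - z)`, so the numerator is `(1 - z) q + E zᴺ`, with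
  -- value `E` at 1.
  let q : ℤ[X] := (hilbertSeries I).trunc N
  let p : ℤ[X] := (1 - X) * q + C (E : ℤ) * X ^ N
  have hp : (p : PowerSeries ℤ) = (1 - PowerSeries.X) * hilbertSeries I := by
    have hs : hilbertSeries I =
        (q : PowerSeries ℤ) + PowerSeries.C (E : ℤ) * PowerSeries.X ^ N * PowerSeries.mk 1 := by
      ext n
      rw [map_add, mul_right_comm, PowerSeries.coeff_mul_X_pow', Polynomial.coeff_coe,
        PowerSeries.coeff_trunc]
      simp only [hilbertSeries, PowerSeries.coeff_mk, PowerSeries.coeff_C_mul, Pi.one_apply, mul_one]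
      split_ifs <;> first | omega | simp
      rw [h n ‹_›]
    have h1 : PowerSeries.mk 1 * (1 - PowerSeries.X : PowerSeries ℤ) = 1 :=
      PowerSeries.mk_one_mul_one_sub_eq_one ℤ
    rw [hs]
    simp only [p, Polynomial.coe_add, Polynomial.coe_mul, Polynomial.coe_sub, Polynomial.coe_one,
      Polynomial.coe_X, Polynomial.coe_pow, Polynomial.coe_C]
    linear_combination (-(PowerSeries.C (E : ℤ) * PowerSeries.X ^ N)) * h1
  have H : ∃ h : ℤ[X], (h : PowerSeries ℤ) = (1 - PowerSeries.X) * hilbertSeries I := ⟨p, hp⟩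
  have hh : hPolynomial I = p := by
    rw [hPolynomial, dif_pos H]
    exact Polynomial.coe_injective ℤ (H.choose_spec.trans hp.symm)
  simp [multiplicity, hh, p]

end Hilbert

/-! ### Conductor, blowing-up and the modules `aR̄` inside `K` -/

section Fractional

variable {R : Type*} (K : Type*) [CommRing R] [Field K] [Algebra R K]

/-- The `R`-submodule `a R̄` of `K`. -/
def scaledRbar (a : R) : Submodule R K :=
  (Rbar R K).map (LinearMap.mulLeft R (algebraMap R K a))

variable {K}

theorem mem_scaledRbar {a : R} {z : K} :
    z ∈ scaledRbar K a ↔ ∃ r : K, IsIntegral R r ∧ algebraMap R K a * r = z :=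
  Iff.rfl

theorem mem_toK {I : Ideal R} {z : K} : z ∈ toK K I ↔ ∃ a ∈ I, algebraMap R K a = z :=
  IsLocalization.mem_coeSubmodule K I

theorem scaledRbar_le_Rbar (a : R) : scaledRbar K a ≤ Rbar R K := by
  rintro _ ⟨r, hr, rfl⟩
  exact isIntegral_algebraMap.mul hr

theorem scaledRbar_mul_le (a b : R) : scaledRbar K (a * b) ≤ scaledRbar K a := by
  rintro _ ⟨r, hr, rfl⟩
  exact ⟨algebraMap R K b * r, isIntegral_algebraMap.mul hr, by simp⟩

theorem mul_mem_conductor {z r : K} (hz : z ∈ conductor R K) (hr : IsIntegral R r) :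
    z * r ∈ conductor R K := by
  rw [conductor, Submodule.mem_div_iff_forall_mul_mem] at hz ⊢
  intro y hy
  rw [mul_assoc]
  exact hz _ (hr.mul hy)

theorem conductor_le_one : conductor R K ≤ 1 := by
  intro z hz
  rw [conductor, Submodule.mem_div_iff_forall_mul_mem] at hz
  simpa using hz 1 isIntegral_one

theorem one_le_Rbar : (1 : Submodule R K) ≤ Rbar R K := by
  intro z hz
  obtain ⟨a, rfl⟩ := Submodule.mem_one.1 hz
  exact isIntegral_algebraMap (R := R) (A := K)

theorem toK_le_one (I : Ideal R) : toK K I ≤ 1 := by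
  rw [← IsLocalization.coeSubmodule_top (R := R) K]
  exact IsLocalization.coeSubmodule_mono K le_top

/-- An `R̄`-submodule of `K` of the form `a R̄` contained in `R` lies in the conductor. -/
theorem scaledRbar_le_conductor {a : R} (h : scaledRbar K a ≤ 1) :
    scaledRbar K a ≤ conductor R K := by
  rintro _ ⟨r, hr, rfl⟩
  rw [conductor, Submodule.mem_div_iff_forall_mul_mem]
  intro y hy
  exact h (mem_scaledRbar.2 ⟨r * y, hr.mul hy, by simp [mul_assoc]⟩)

theorem Rbar_le_blowup {I : Ideal R} {a : R} {k : ℕ} (h : toK K (I ^ k) = scaledRbar K a) :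
    Rbar R K ≤ blowup K I := by
  intro r hr
  refine Submodule.mem_iSup_of_mem k ?_
  rw [Submodule.mem_div_iff_forall_mul_mem, h]
  rintro _ ⟨s, hs, rfl⟩
  exact ⟨r * s, IsIntegral.mul hr hs, by simp [mul_left_comm]⟩

variable [IsFractionRing R K]

theorem algebraMap_mem_toK {I : Ideal R} {a : R} : algebraMap R K a ∈ toK K I ↔ a ∈ I := by
  rw [mem_toK]
  constructor
  · rintro ⟨b, hb, h⟩
    rwa [← IsFractionRing.injective R K h]
  · exact fun h => ⟨a, h, rfl⟩

theorem quotLength_toK (I J : Ideal R) : quotLength (toK K I) (toK K J) = quotLength I J :=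
  quotLength_map (Algebra.linearMap R K) (IsFractionRing.injective R K)

theorem mulLeft_algebraMap_injective {a : R} (ha : a ≠ 0) :
    Function.Injective (LinearMap.mulLeft R (algebraMap R K a)) :=
  mul_right_injective₀ ((map_ne_zero_iff _ (IsFractionRing.injective R K)).2 ha)

theorem quotLength_scaledRbar {a : R} (ha : a ≠ 0) (b : R) :
    quotLength (scaledRbar K a) (scaledRbar K (a * b)) =
      quotLength (Rbar R K) (scaledRbar K b) := by
  have : scaledRbar K (a * b) =
      (scaledRbar K b).map (LinearMap.mulLeft R (algebraMap R K a)) := by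
    rw [scaledRbar, scaledRbar, ← Submodule.map_comp]
    congr 1
    ext z
    simp
  rw [this, scaledRbar, quotLength_map _ (mulLeft_algebraMap_injective ha)]

/-- If the ideal `I ^ k` is the conductor, it equals `x ^ k R̄`. -/
theorem scaledRbar_le_of_conductor_eq {I : Ideal R} {x : R} (hxI : x ∈ I) {k : ℕ}
    (h : conductor R K = toK K (I ^ k)) : scaledRbar K (x ^ k) ≤ toK K (I ^ k) := by
  rintro _ ⟨r, hr, rfl⟩
  rw [← h]
  refine mul_mem_conductor ?_ hr
  rw [h, algebraMap_mem_toK]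
  exact Ideal.pow_mem_pow hxI k

variable [IsDomain R]

/-- An element `r` of `R̄ = Λ(I)` satisfies `r Iⁿ ⊆ Iⁿ` for some `n`. Hence `xⁿ · xᵏr` lies in `Iᵏ⁺ⁿ
= xⁿIᵏ`, and `xⁿ` cancels. -/
theorem scaledRbar_le_of_blowup_eq {I : Ideal R} {x : R} (hxI : x ∈ I) (hx0 : x ≠ 0) {k : ℕ}
    (hk : ∀ n ≥ k, I ^ (n + 1) = Ideal.span {x} * I ^ n) (h : blowup K I = Rbar R K) :
    scaledRbar K (x ^ k) ≤ toK K (I ^ k) := by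
  rintro _ ⟨r, hr, rfl⟩
  have hr' : r ∈ (blowup K I : Set K) := by rw [h]; exact hr
  rw [coe_blowup, Set.mem_iUnion] at hr'
  obtain ⟨n, hn⟩ := hr'
  rw [SetLike.mem_coe, Submodule.mem_div_iff_forall_mul_mem] at hn
  obtain ⟨b, hb, hbr⟩ :=
    mem_toK.1 (hn _ (algebraMap_mem_toK.2 (Ideal.pow_mem_pow hxI n)))
  have hxb : x ^ k * b ∈ I ^ (k + n) := by
    rw [pow_add]
    exact Ideal.mul_mem_mul (Ideal.pow_mem_pow hxI k) hb
  rw [pow_add_eq_of_reduction hk le_rfl, Ideal.mem_span_singleton_mul] at hxb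
  obtain ⟨d, hd, hdb⟩ := hxb
  refine mem_toK.2 ⟨d, hd, ?_⟩
  have hxn : algebraMap R K (x ^ n) ≠ 0 :=
    (map_ne_zero_iff _ (IsFractionRing.injective R K)).2 (pow_ne_zero n hx0)
  apply mul_left_cancel₀ hxn
  rw [← map_mul, hdb, map_mul, hbr, LinearMap.mulLeft_apply]
  ring

variable [IsNoetherianRing R]

/-- Powers of an ideal lie in the multiples of the integral closure by the powers of a
minimal reduction. -/
theorem IsMinimalReduction.toK_pow_le_scaledRbar {I : Ideal R} {x : R}
    (hx : IsMinimalReduction I x) (hI : I ≠ ⊥) (k : ℕ) :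
    toK K (I ^ k) ≤ scaledRbar K (x ^ k) := by
  have hx0 := hx.ne_zero hI
  obtain ⟨-, N, hN⟩ := hx
  have hxK : algebraMap R K (x ^ k) ≠ 0 :=
    (map_ne_zero_iff _ (IsFractionRing.injective R K)).2 (pow_ne_zero k hx0)
  intro z hz
  obtain ⟨y, hy, rfl⟩ := mem_toK.1 hz
  refine mem_scaledRbar.2 ⟨algebraMap R K y / algebraMap R K (x ^ k), ?_, by field_simp⟩
  -- The quotient `y/xᵏ` stabilises the nonzero finitely generated module `Iᴺ`, since `y Iᴺ ⊆ Iᴺ⁺ᵏ =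
  -- xᵏIᴺ`.
  refine isIntegral_of_smul_mem_submodule (toK K (I ^ N)) ?_ ?_ _ ?_
  · rw [Ne, Submodule.eq_bot_iff]
    intro h
    refine pow_ne_zero N (show I ≠ 0 from hI) (eq_bot_iff.2 fun a ha => ?_)
    have := h _ (algebraMap_mem_toK (K := K) |>.2 ha)
    exact (map_eq_zero_iff _ (IsFractionRing.injective R K)).1 this
  · exact Submodule.FG.map _ (IsNoetherian.noetherian _)
  · intro w hw
    obtain ⟨b, hb, rfl⟩ := mem_toK.1 hw
    have hyb : y * b ∈ I ^ (N + k) := by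
      rw [add_comm, pow_add]
      exact Ideal.mul_mem_mul hy hb
    rw [pow_add_eq_of_reduction hN le_rfl, Ideal.mem_span_singleton_mul] at hyb
    obtain ⟨d, hd, hdy⟩ := hyb
    refine mem_toK.2 ⟨d, hd, ?_⟩
    rw [smul_eq_mul, div_mul_eq_mul_div, eq_div_iff hxK, ← map_mul, ← map_mul, ← hdy, mul_comm]

/-- Equality propagates upwards from `k`: `xⁿR̄ = xⁿ⁻ᵏ · xᵏR̄ ⊆ xⁿ⁻ᵏIᵏ ⊆ Iⁿ`. -/
theorem IsMinimalReduction.toK_pow_eq_scaledRbar {I : Ideal R} {x : R}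
    (hx : IsMinimalReduction I x) (hI : I ≠ ⊥) {k : ℕ} (hk : scaledRbar K (x ^ k) ≤ toK K (I ^ k))
    {n : ℕ} (hn : k ≤ n) : toK K (I ^ n) = scaledRbar K (x ^ n) := by
  refine le_antisymm (hx.toK_pow_le_scaledRbar hI n) ?_
  rintro _ ⟨r, hr, rfl⟩
  obtain ⟨a, ha, h⟩ := mem_toK.1 (hk ⟨r, hr, rfl⟩)
  obtain ⟨j, rfl⟩ := Nat.exists_eq_add_of_le' hn
  refine mem_toK.2 ⟨x ^ j * a, ?_, ?_⟩
  · rw [pow_add]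
    exact Ideal.mul_mem_mul (Ideal.pow_mem_pow hx.1 j) ha
  · rw [map_mul, h]
    simp [pow_add]

theorem blowup_le_Rbar {I : Ideal R} (hI : I ≠ ⊥) : blowup K I ≤ Rbar R K := by
  refine iSup_le fun n z hz => ?_
  rw [Submodule.mem_div_iff_forall_mul_mem] at hz
  refine isIntegral_of_smul_mem_submodule (toK K (I ^ n)) ?_ ?_ z hz
  · rw [Ne, Submodule.eq_bot_iff]
    intro h
    refine pow_ne_zero n (show I ≠ 0 from hI) (eq_bot_iff.2 fun a ha => ?_)
    have := h _ (algebraMap_mem_toK (K := K) |>.2 ha)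
    exact (map_eq_zero_iff _ (IsFractionRing.injective R K)).1 this
  · exact Submodule.FG.map _ (IsNoetherian.noetherian _)

end Fractional

/-! ### Length computations and the reduction exponent for the maximal ideal -/

section Local

theorem quotLength_top_maximalIdeal {R : Type*} [CommRing R] [IsLocalRing R] :
    quotLength (⊤ : Ideal R) (maximalIdeal R) = 1 := by
  have h : IsSimpleModule R (R ⧸ maximalIdeal R) :=
    isSimpleModule_iff_isCoatom.2 (maximalIdeal.isMaximal R).out
  have e : ((⊤ : Ideal R) ⧸ (maximalIdeal R).submoduleOf ⊤) ≃ₗ[R] R ⧸ maximalIdeal R := by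
    refine Submodule.Quotient.equiv _ _ Submodule.topEquiv ?_
    ext z
    constructor
    · rintro ⟨w, hw, rfl⟩
      exact hw
    · intro hz
      exact ⟨⟨z, trivial⟩, hz, rfl⟩
  rw [quotLength, e.length_eq, Module.length_eq_one]
  rfl

variable {R K : Type*} [CommRing R] [IsLocalRing R] [IsNoetherianRing R] [Field K]
  [Algebra R K] [IsFractionRing R K] {x : R}

/-- The quotient is finite over `R` and killed by `𝔪ᵏ`, because `𝔪ᵏR̄ = xᵏR̄`. -/
theorem length_Rbar_quotient_ne_top [Module.Finite R (integralClosure R K)]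
    {k : ℕ} (hk0 : k ≠ 0)
    (hk : toK K (maximalIdeal R ^ k) = scaledRbar K (x ^ k)) :
    Module.length R (Rbar R K ⧸ (scaledRbar K (x ^ k)).submoduleOf (Rbar R K)) ≠ ⊤ := by
  have : Module.Finite R (Rbar R K) := ‹Module.Finite R (integralClosure R K)›
  refine length_ne_top_of_pow_smul_eq_zero hk0 fun a ha z => ?_
  obtain ⟨⟨z, hz⟩, rfl⟩ := Submodule.mkQ_surjective _ z
  rw [← map_smul, Submodule.mkQ_apply, Submodule.Quotient.mk_eq_zero]
  have ha' : algebraMap R K a ∈ scaledRbar K (x ^ k) := hk ▸ algebraMap_mem_toK.2 ha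
  obtain ⟨r, hr, h⟩ := ha'
  refine mem_scaledRbar.2 ⟨r * z, IsIntegral.mul hr hz, ?_⟩
  rw [← mul_assoc]
  change _ = a • z
  rw [Algebra.smul_def, ← h]
  rfl

/-- Additivity along `𝔪² ⊆ 𝔪 ⊆ R ⊆ R̄`, whose steps have lengths `μ`, 1 and `δ`. -/
theorem quotLength_scaledRbar_sq_eq_singularityDegree_add [Module.Finite R (integralClosure R K)]
    (h : toK K (maximalIdeal R ^ 2) = scaledRbar K (x ^ 2)) :
    quotLength (Rbar R K) (scaledRbar K (x ^ 2)) = embDim R + 1 + singularityDegree R K := by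
  have hfin := length_Rbar_quotient_ne_top two_ne_zero h
  have hle : scaledRbar K (x ^ 2) ≤ 1 := h ▸ toK_le_one _
  have hfin' := hfin
  rw [length_quotient_add hle one_le_Rbar] at hfin'
  replace hfin' := (WithTop.add_ne_top.1 hfin').1
  rw [quotLength_add hle one_le_Rbar hfin, singularityDegree]
  congr 1
  rw [← h] at hfin' ⊢
  rw [quotLength_add (IsLocalization.coeSubmodule_mono K (Ideal.pow_le_self two_ne_zero))
    (toK_le_one (maximalIdeal R)) hfin', quotLength_toK, embDim,
    ← IsLocalization.coeSubmodule_top (R := R) K, quotLength_toK, quotLength_top_maximalIdeal]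

variable [IsDomain R]

/-- If `𝔪 ^ k = x ^ k R̄`, the multiplicity is `l_R(R̄ / x R̄)`. -/
theorem multiplicity_eq_quotLength (hx : IsMinimalReduction (maximalIdeal R) x)
    (hm : maximalIdeal R ≠ ⊥) {k : ℕ}
    (hk : scaledRbar K (x ^ k) ≤ toK K (maximalIdeal R ^ k)) :
    multiplicity (maximalIdeal R) = (quotLength (Rbar R K) (scaledRbar K x) : ℤ) := by
  refine multiplicity_eq_of_hilbertFunction_eq (N := k) fun n hn => ?_
  rw [hilbertFunction, ← quotLength_toK (K := K), hx.toK_pow_eq_scaledRbar hm hk hn,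
    hx.toK_pow_eq_scaledRbar hm hk (hn.trans n.le_succ), pow_succ,
    quotLength_scaledRbar (pow_ne_zero n (hx.ne_zero hm))]

theorem quotLength_scaledRbar_sq [Module.Finite R (integralClosure R K)]
    (hx : IsMinimalReduction (maximalIdeal R) x)
    (hm : maximalIdeal R ≠ ⊥) (h : toK K (maximalIdeal R ^ 2) = scaledRbar K (x ^ 2)) :
    quotLength (Rbar R K) (scaledRbar K (x ^ 2)) =
      2 * quotLength (Rbar R K) (scaledRbar K x) := by
  rw [quotLength_add (N := scaledRbar K x) (by rw [pow_two]; exact scaledRbar_mul_le x x)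
    (scaledRbar_le_Rbar x) (length_Rbar_quotient_ne_top two_ne_zero h), pow_two,
    quotLength_scaledRbar (hx.ne_zero hm), two_mul]

/-- If `𝔪² = x𝔪`, cancelling `x` in `x²R̄ ⊆ 𝔪²` gives `xR̄ ⊆ 𝔪`. Then `𝔪 ⊆ xR̄ ⊆ γ = 𝔪²`, against
Nakayama. -/
theorem sq_ne_span_mul_of_conductor_eq (hm : maximalIdeal R ≠ ⊥)
    (hx : IsMinimalReduction (maximalIdeal R) x)
    (h : conductor R K = toK K (maximalIdeal R ^ 2)) :
    maximalIdeal R ^ 2 ≠ Ideal.span {x} * maximalIdeal R := by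
  intro hsq
  have hxK : algebraMap R K x ≠ 0 :=
    (map_ne_zero_iff _ (IsFractionRing.injective R K)).2 (hx.ne_zero hm)
  have h₂ := scaledRbar_le_of_conductor_eq hx.1 h
  have h₁ : scaledRbar K x ≤ toK K (maximalIdeal R) := by
    rintro _ ⟨r, hr, rfl⟩
    obtain ⟨a, ha, har⟩ := mem_toK.1 (h₂ ⟨r, hr, rfl⟩)
    rw [hsq, Ideal.mem_span_singleton_mul] at ha
    obtain ⟨b, hb, rfl⟩ := ha
    refine mem_toK.2 ⟨b, hb, mul_left_cancel₀ hxK ?_⟩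
    rw [← map_mul, har]
    simp [pow_two]
  have hle : toK K (maximalIdeal R) ≤ toK K (maximalIdeal R ^ 2) := by
    have := hx.toK_pow_le_scaledRbar (K := K) hm 1
    rw [pow_one, pow_one] at this
    rw [← h]
    exact this.trans (scaledRbar_le_conductor (h₁.trans (toK_le_one _)))
  have hle' : maximalIdeal R ≤ maximalIdeal R ^ 2 := fun a ha =>
    algebraMap_mem_toK.1 (hle (algebraMap_mem_toK.2 ha))
  refine hm (Submodule.eq_bot_of_le_smul_of_le_jacobson_bot (maximalIdeal R) _
    (IsNoetherian.noetherian _) ?_ (maximalIdeal_le_jacobson _))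
  rwa [smul_eq_mul, ← pow_two]

theorem reductionExponent_eq_two (hm : maximalIdeal R ≠ ⊥)
    (hx : IsMinimalReduction (maximalIdeal R) x)
    (h : conductor R K = toK K (maximalIdeal R ^ 2)) :
    reductionExponent (maximalIdeal R) x = 2 := by
  have hn {n : ℕ} (hn : 2 ≤ n) : toK K (maximalIdeal R ^ n) = scaledRbar K (x ^ n) :=
    hx.toK_pow_eq_scaledRbar hm (scaledRbar_le_of_conductor_eq hx.1 h) hn
  have hmem : 2 ∈ {ν : ℕ | ∀ n ≥ ν,
      maximalIdeal R ^ (n + 1) = Ideal.span {x} * maximalIdeal R ^ n} := by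
    intro n hn2
    refine le_antisymm (fun a ha => ?_) ?_
    · have ha' := algebraMap_mem_toK (K := K).2 ha
      rw [hn (by omega)] at ha'
      obtain ⟨r, hr, har⟩ := ha'
      have hb : algebraMap R K (x ^ n) * r ∈ toK K (maximalIdeal R ^ n) := by
        rw [hn hn2]
        exact ⟨r, hr, rfl⟩
      obtain ⟨b, hb, hbr⟩ := mem_toK.1 hb
      refine Ideal.mem_span_singleton_mul.2 ⟨b, hb, IsFractionRing.injective R K ?_⟩
      rw [map_mul, hbr, ← har]
      simp [pow_succ']
    · rw [pow_succ']
      exact Ideal.mul_mono_left ((Ideal.span_singleton_le_iff_mem _).2 hx.1)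
  refine le_antisymm (Nat.sInf_le hmem) ?_
  by_contra hlt
  -- An exponent at most 1 would make the reduction identity hold at `n = 1`, i.e. `𝔪² = x𝔪`.
  have := Nat.sInf_mem ⟨2, hmem⟩ 1 (by rw [reductionExponent] at hlt; omega)
  rw [pow_one] at this
  exact sq_ne_span_mul_of_conductor_eq hm hx h this

end Local

end BlowUp

/-! ### The equivalence -/

open BlowUp in
theorem proposition6p11 {R K : Type*} [CommRing R] [IsDomain R] [IsLocalRing R]
    [IsNoetherianRing R] (hdim : ringKrullDim R = 1)
    [Infinite (IsLocalRing.ResidueField R)]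
    [Field K] [Algebra R K] [IsFractionRing R K]
    [Module.Finite R (integralClosure R K)]
    [IsDiscreteValuationRing (integralClosure R K)]
    (hres : BlowUp.IsResiduallyRational R K)
    (hnp : ¬ (IsLocalRing.maximalIdeal R).IsPrincipal)
    (x : R) (hx : BlowUp.IsMinimalReduction (IsLocalRing.maximalIdeal R) x) :
    BlowUp.conductor R K = BlowUp.toK K (IsLocalRing.maximalIdeal R ^ 2) ↔
      (BlowUp.blowup K (IsLocalRing.maximalIdeal R) = BlowUp.Rbar R K ∧
        (BlowUp.multiplicity (IsLocalRing.maximalIdeal R) : ℚ) - ((BlowUp.embDim R : ℚ) + 1) =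
          (2 * (BlowUp.singularityDegree R K : ℚ) - (BlowUp.conductorExponent R K : ℚ)) / 2 ∧
        BlowUp.reductionExponent (IsLocalRing.maximalIdeal R) x = 2) := by
  have hm : IsLocalRing.maximalIdeal R ≠ ⊥ := fun h => hnp (h ▸ inferInstance)
  constructor
  · intro h
    have hle := scaledRbar_le_of_conductor_eq hx.1 h
    have heq := hx.toK_pow_eq_scaledRbar hm hle le_rfl
    refine ⟨le_antisymm (blowup_le_Rbar hm) (Rbar_le_blowup heq), ?_,
      reductionExponent_eq_two hm hx h⟩
    have h₁ := quotLength_scaledRbar_sq hx hm heq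
    have h₂ := quotLength_scaledRbar_sq_eq_singularityDegree_add heq
    rw [multiplicity_eq_quotLength hx hm hle, conductorExponent, h, heq, h₁]
    rw [h₁] at h₂
    have h₂' := congrArg (Nat.cast : ℕ → ℚ) h₂
    push_cast at h₂' ⊢
    -- Here `c = 2e` and `2e = μ + 1 + δ`, so both sides equal `δ - e`.
    linarith
  · rintro ⟨hb, he, hν⟩
    have hred : ∀ n ≥ 2, IsLocalRing.maximalIdeal R ^ (n + 1) =
        Ideal.span {x} * IsLocalRing.maximalIdeal R ^ n := by
      -- Being a minimal reduction makes this set nonempty, so its infimum is attained.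
      have := Nat.sInf_mem (s := {ν : ℕ | ∀ n ≥ ν, IsLocalRing.maximalIdeal R ^ (n + 1) =
        Ideal.span {x} * IsLocalRing.maximalIdeal R ^ n}) hx.2
      rw [reductionExponent] at hν
      rwa [hν] at this
    have hle := scaledRbar_le_of_blowup_eq hx.1 (hx.ne_zero hm) hred hb
    have heq := hx.toK_pow_eq_scaledRbar hm hle le_rfl
    have h₁ := quotLength_scaledRbar_sq hx hm heq
    have h₂ := quotLength_scaledRbar_sq_eq_singularityDegree_add heq
    rw [multiplicity_eq_quotLength hx hm hle] at he
    have hle1 : scaledRbar K (x ^ 2) ≤ 1 := hle.trans (toK_le_one _)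
    rw [heq]
    refine (eq_of_quotLength_eq (scaledRbar_le_conductor hle1)
      (conductor_le_one.trans one_le_Rbar) (length_Rbar_quotient_ne_top two_ne_zero heq) ?_).symm
    rw [← conductorExponent]
    rw [h₁] at h₂ ⊢
    have h₂' := congrArg (Nat.cast : ℕ → ℚ) h₂
    rw [← Nat.cast_inj (R := ℚ)]
    push_cast at h₂' he ⊢
    -- Substituting `μ + 1 = 2e - δ` in the numerical condition leaves `c = 2e`.
    linarith
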